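/- \textbf{Theorem.} Let $d=d(n)$ and $q=q(n)$ be bounded by polynomials in $n$ (in particular $d$ may be a constant). There is a negligible function $\varepsilon$, depending only on $d$ and $q$, such that for every $n$, every ${\rm QNC}_d$ circuit $\mathcal A$ on $q$ qubits with oracle access to the $d$-SCS oracles $\mathcal O=(\mathcal S,\Xi,p',p'_{\rm inv})$ of size $n$, followed by classical post-processing (possibly randomized and computationally unbounded, but making no further oracle queries), and every density matrix $\rho_0$ on $q$ qubits that does not depend on the oracles, \[ \Pr[s\leftarrow \mathcal A^{\mathcal O}(\rho_0)]\le \varepsilon(n), \] where $(\mathcal S,\Xi,p',p'_{\rm inv},s)$ is a random $d$-SCS instance and the probability is over the instance, the internal randomness of $\mathcal S$, the final measurement and the post-processing. Here: \emph{Circuits.} $\mathcal A^{\mathcal O}=U_{d+1}\circ\mathcal O\circ U_d\circ\cdots\circ\mathcal O\circ U_1$, followed by a measurement of all qubits in the computational basis. Each $U_i$ is a single layer unitary: one- and two-qubit gates acting on disjoint qubits. Each $\mathcal O$ is one round of parallel queries (arbitrarily many that fit on the $q$ qubits), each to one of the oracles $\mathcal S$, $f_0,\dots,f_d$ (the functions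 that make up $\Xi$), $p'$, $p'_{\rm inv}$, on pairwise disjoint registers; a query to a function $F$ acts by $|x\rangle|a\rangle\mapsto|x\rangle|a\oplus F(x)\rangle$, with the values in $\{0,1\}^m\cup\{\perp\}$ encoded by $m+1$ bits. A function $\varepsilon$ is negligible if $n^k\varepsilon(n)\to0$ for all $k$. \emph{Random $d$-SCS instance of size $n$.} Strings are identified with the integers they represent in binary. Sample independently and uniformly: a two-to-one function $f:\{0,1\}^n\to\{0,1\}^n$ (every point collides with exactly one other point); a Simon's function $g$ with its period $s$, that is, a pair $(g,s)$ with $g:\{0,1\}^n\to\{0,1\}^n$ two-to-one, $s\ne0^n$ and $g(x\oplus s)=g(x)$ for all $x$; a permutation $h$ of $\{0,1\}^n$; and $t_0,\dots,t_{d-1}$, each a tuple of $2^n$ distinct elements of $\{0,1\}^{2n}$. \begin{itemize} \item Let $p$ be the bijection of $\{0,1\}^n$ that, for every $k\in\{1,\dots,2^{n-1}\}$, maps the two pre-images under $f$ of the $k$-th largest value of $f$, in ascending order, to the two pre-images under $g$ of the $k$-th largest value of $g$, in ascending order. \item $\mathcal S$ is intrinsically stochastic: at each query it draws a fresh $y$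 uniformly from the image of $f$ (the same $y$ for all branches of a superposition, independent for different queries, parallel ones included) and then acts as the oracle of the function $b\mapsto(f^{-1}(y)[b],y)$, $b\in\{0,1\}$, where $f^{-1}(y)[0]<f^{-1}(y)[1]$ are the two pre-images of $y$. \item $\Xi$ is the $d$-Shuffler $(f_0,\dots,f_d)$ encoding $h$: with $t_{-1}=(0^n x)_{x\in\{0,1\}^n}$ and $t_d=(0^n h(x))_{x\in\{0,1\}^n}$, the function $f_i:\{0,1\}^{2n}\cup\{\perp\}\to\{0,1\}^{2n}\cup\{\perp\}$ maps the $j$-th element of $t_{i-1}$ to the $j$-th element of $t_i$ and everything else to $\perp$. \item $p'(a,x)=p(x)$ if $a=h(f(x))$ and $p'(a,x)=\perp$ otherwise; $p'_{\rm inv}(a,p(x))=x$ if $a=h(f(x))$ and $p'_{\rm inv}(a,p(x))=\perp$ otherwise, for $a,x\in\{0,1\}^n$. \end{itemize} -/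

import Mathlib

open scoped BigOperators Matrix ComplexOrder
open Filter

namespace SCS

noncomputable section

/-! ### Bit strings -/

/-- The set `{0,1}^n`.  Addition is bitwise XOR and `0` is the all-zero string. -/
abbrev Bits (n : ℕ) : Type := Fin n → ZMod 2

/-- The identification of an `n`-bit string with the integer it represents in binary, the first bit
being the most significant one. -/
def bitsVal (n : ℕ) : Bits n ≃ Fin (2 ^ n) :=
  (Equiv.arrowCongr Fin.revPerm (Equiv.refl (ZMod 2))).trans
    (finFunctionFinEquiv : (Fin n → Fin 2) ≃ Fin (2 ^ n))

/-- Encoding of `{0,1}^m ∪ {⊥}` (with `⊥ = none`) by `m + 1` bits; the last bit flags `⊥`. -/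
def encodeBot {m : ℕ} : Option (Bits m) → Bits (m + 1)
  | some x => Fin.snoc (α := fun _ => ZMod 2) x 0
  | none => Fin.snoc (α := fun _ => ZMod 2) 0 1

/-- Reading `m + 1` bits as an element of `{0,1}^m ∪ {⊥}`, a left inverse of `encodeBot`. -/
def decodeBot {m : ℕ} (v : Bits (m + 1)) : Option (Bits m) :=
  if v (Fin.last m) = 0 then some (Fin.init (α := fun _ => ZMod 2) v) else none

/-! ### Two-to-one functions, Simon's functions and the Collisions-to-Simons map -/

/-- Every point collides with exactly one other point. -/
def IsTwoToOne {n : ℕ} (f : Bits n → Bits n) : Prop :=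
  ∀ x₀, ∃! x₁, x₁ ≠ x₀ ∧ f x₀ = f x₁

open Classical in
/-- The set of all two-to-one functions on `{0,1}^n`. -/
def twoToOne (n : ℕ) : Finset (Bits n → Bits n) :=
  Finset.univ.filter IsTwoToOne

open Classical in
/-- The set of all pairs `(g, s)` of a Simon's function on `{0,1}^n` and its (nonzero) period. -/
def simonPairs (n : ℕ) : Finset ((Bits n → Bits n) × Bits n) :=
  Finset.univ.filter fun gs => IsTwoToOne gs.1 ∧ gs.2 ≠ 0 ∧ ∀ x, gs.1 (x + gs.2) = gs.1 x

/-- The list of pre-images of `y` under `f` in ascending order. -/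
def preimages {n : ℕ} (f : Bits n → Bits n) (y : Bits n) : List (Bits n) :=
  ((Finset.univ.filter fun i : Fin (2 ^ n) => f ((bitsVal n).symm i) = y).sort (· ≤ ·)).map
    (bitsVal n).symm

/-- The enumeration of the domain of `f` in which `x` comes before `x'` iff `f x < f x'`, or
`f x = f x'` and `x < x'`. For a two-to-one function this lists the colliding pairs one after the
other, by increasing common value, each pair in ascending order. -/
def enumeration {n : ℕ} (f : Bits n → Bits n) : Fin (2 ^ n) ≃ Bits n :=
  (Tuple.sort fun i : Fin (2 ^ n) => bitsVal n (f ((bitsVal n).symm i))).trans (bitsVal n).symm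

/-- The Collisions-to-Simons map from `f` to `g`: for each `k` it maps the (ordered) pair of
pre-images of the `k`-th value of `f` to the (ordered) pair of pre-images of the `k`-th value
of `g`. -/
def csMap {n : ℕ} (f g : Bits n → Bits n) : Equiv.Perm (Bits n) :=
  (enumeration f).symm.trans (enumeration g)

/-! ### Instances of the problem and their oracles -/

/-- The data drawn by the sampling procedure: the two-to-one function `f`, the Simon's function
`g`, the permutation `h`, and the tuples `t₀, …, t_{d-1}` of the shuffler, each consisting of `2^n`
distinct elements of `{0,1}^{2n}` (indexed by `{0,1}^n`, i.e. by `0, …, 2^n - 1`). -/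
structure Data (n d : ℕ) where
  /-- the two-to-one function -/
  f : Bits n → Bits n
  /-- the Simon's function -/
  g : Bits n → Bits n
  /-- the hidden permutation -/
  h : Equiv.Perm (Bits n)
  /-- the tuples of the shuffler -/
  t : Fin d → (Bits n ↪ Bits (n + n))

variable {n d : ℕ}

/-- The tuples `t_{-1}, t₀, …, t_{d-1}, t_d` of the `d`-Shuffler encoding `h`, numbered from `0` to
`d + 1`; the first one is `x ↦ 0ⁿx` and the last one is `x ↦ 0ⁿh(x)`. -/
def Data.tuples (I : Data n d) : Fin (d + 2) → Bits n → Bits (n + n) :=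
  Fin.cons (fun x => Fin.append 0 x)
    (Fin.snoc (α := fun _ => Bits n → Bits (n + n)) (fun i => ⇑(I.t i))
      (fun x => Fin.append 0 (I.h x)))

/-- The `i`-th function `{0,1}^{2n} ∪ {⊥} → {0,1}^{2n} ∪ {⊥}` of the `d`-Shuffler, `0 ≤ i ≤ d`:
it maps the `j`-th element of `t_{i-1}` to the `j`-th element of `t_i`, and everything else
to `⊥`. -/
def Data.shuffler (I : Data n d) (i : Fin (d + 1)) (v : Option (Bits (n + n))) :
    Option (Bits (n + n)) :=
  (v.bind (Function.partialInv (I.tuples i.castSucc))).map (I.tuples i.succ)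

/-- The Collisions-to-Simons map of the instance. -/
def Data.p (I : Data n d) : Equiv.Perm (Bits n) := csMap I.f I.g

/-- The encrypted map `p'`: `p'(h(f(x)), x) = p(x)`, and `⊥` on all other inputs. -/
def Data.enc (I : Data n d) (a x : Bits n) : Option (Bits n) :=
  if a = I.h (I.f x) then some (I.p x) else none

/-- The encrypted map `p'_inv`: `p'_inv(h(f(x)), p(x)) = x`, and `⊥` on all other inputs. -/
def Data.encInv (I : Data n d) (a z : Bits n) : Option (Bits n) :=
  if a = I.h (I.f (I.p.symm z)) then some (I.p.symm z) else none

/-- Names of the oracles: the stochastic oracle `𝒮`, the `d + 1` functions of the `d`-Shuffler,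
`p'` and `p'_inv`. -/
inductive SubOracle (d : ℕ) : Type
  | stoch : SubOracle d
  | shuffler (i : Fin (d + 1)) : SubOracle d
  | enc : SubOracle d
  | encInv : SubOracle d

/-- Number of qubits of the query register. -/
def SubOracle.inLen (n : ℕ) : SubOracle d → ℕ
  | stoch => 1
  | shuffler _ => n + n + 1
  | enc => n + n
  | encInv => n + n

/-- Number of qubits of the response register. -/
def SubOracle.outLen (n : ℕ) : SubOracle d → ℕ
  | stoch => n + n
  | shuffler _ => n + n + 1
  | enc => n + 1
  | encInv => n + 1

/-- The value returned by an oracle. The argument `y` is the value sampled by the stochastic oracle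
for the query at hand, which then returns `(f⁻¹(y)[b], y)` on input `b`; the other oracles do not
use it. -/
def Data.answer (I : Data n d) (y : Bits n) :
    (k : SubOracle d) → Bits (k.inLen n) → Bits (k.outLen n)
  | .stoch, b => Fin.append ((preimages I.f y).getD (b (0 : Fin 1)).val 0) y
  | .shuffler i, v => encodeBot (I.shuffler i (decodeBot v))
  | .enc, v =>
      encodeBot (I.enc (fun j => v (Fin.castAdd n j)) (fun j => v (Fin.natAdd n j)))
  | .encInv, v =>
      encodeBot (I.encInv (fun j => v (Fin.castAdd n j)) (fun j => v (Fin.natAdd n j)))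

/-! ### Circuits -/

/-- A square matrix acting on `q` qubits, in the computational basis. -/
abbrev Op (q : ℕ) : Type := Matrix (Bits q) (Bits q) ℂ

/-- A density matrix: a positive semidefinite matrix of trace one. -/
def IsDensity {q : ℕ} (ρ : Op q) : Prop := ρ.PosSemidef ∧ ρ.trace = 1

/-- A single layer unitary on `q` qubits: finitely many one- and two-qubit gates that act on
disjoint sets of qubits. -/
structure GateLayer (q : ℕ) where
  /-- number of gates -/
  num : ℕ
  /-- number of qubits of each gate -/
  arity : Fin num → ℕ
  one_or_two : ∀ j, arity j = 1 ∨ arity j = 2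
  /-- the qubits that the gates act on -/
  wire : (Σ j, Fin (arity j)) ↪ Fin q
  /-- the gates -/
  gate : ∀ j, Matrix.unitaryGroup (Bits (arity j)) ℂ

open Classical in
/-- The tensor product of all gates of the layer with the identity on the remaining qubits. -/
def GateLayer.unitary {q : ℕ} (L : GateLayer q) : Op q := fun z z' =>
  if ∀ w, w ∉ Set.range L.wire → z w = z' w then
    ∏ j, (L.gate j : Matrix _ _ ℂ) (fun a => z (L.wire ⟨j, a⟩)) (fun a => z' (L.wire ⟨j, a⟩))
  else 0

/-- One round of parallel queries by a circuit on `q` qubits: finitely many queries, each to some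
oracle, whose query registers (`Sum.inl`) and response registers (`Sum.inr`) are all disjoint. -/
structure QueryLayer (n d q : ℕ) where
  /-- number of queries -/
  num : ℕ
  /-- the oracle that is queried -/
  kind : Fin num → SubOracle d
  /-- the registers -/
  wire : (Σ j, Fin ((kind j).inLen n) ⊕ Fin ((kind j).outLen n)) ↪ Fin q

/-- The action of a round of queries on basis states, `|x⟩|a⟩ ↦ |x⟩|a ⊕ F(x)⟩` for each query,
where `y j` is the value sampled for the `j`-th query. -/
def QueryLayer.act {q : ℕ} (L : QueryLayer n d q) (I : Data n d) (y : Fin L.num → Bits n)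
    (z : Bits q) : Bits q := fun w =>
  z w + ∑ j, ∑ o, if L.wire ⟨j, Sum.inr o⟩ = w then
    I.answer (y j) (L.kind j) (fun a => z (L.wire ⟨j, Sum.inl a⟩)) o else 0

/-- The operator `|z⟩ ↦ |act z⟩`. -/
def QueryLayer.unitary {q : ℕ} (L : QueryLayer n d q) (I : Data n d) (y : Fin L.num → Bits n) :
    Op q := fun z z' => if z = L.act I y z' then 1 else 0

open Classical in
/-- The quantum channel of a round of queries: every query gets its own independent sample from the
uniform distribution on the image of `f`. -/
def QueryLayer.channel {q : ℕ} (L : QueryLayer n d q) (I : Data n d) (ρ : Op q) : Op q :=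
  𝔼 y ∈ Fintype.piFinset (fun _ : Fin L.num => Finset.univ.image I.f),
    L.unitary I y * ρ * (L.unitary I y)ᴴ

/-- A depth-`d` quantum circuit on `q` qubits with access to the oracles of a size-`n` instance:
`d + 1` single layer unitaries `U₁, …, U_{d+1}` and `d` rounds of parallel queries in between. -/
structure QNCCircuit (n d q : ℕ) where
  /-- the single layer unitaries -/
  gates : Fin (d + 1) → GateLayer q
  /-- the rounds of queries -/
  queries : Fin d → QueryLayer n d q

/-- The final state `U_{d+1} ∘ 𝒪 ∘ U_d ∘ ⋯ ∘ 𝒪 ∘ U₁ (ρ₀)`. -/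
def QNCCircuit.run {q : ℕ} (A : QNCCircuit n d q) (I : Data n d) (ρ₀ : Op q) : Op q :=
  Fin.induction (motive := fun _ => Op q)
    ((A.gates 0).unitary * ρ₀ * (A.gates 0).unitaryᴴ)
    (fun i ρ => (A.gates i.succ).unitary * (A.queries i).channel I ρ * (A.gates i.succ).unitaryᴴ)
    (Fin.last d)

/-- The probability that `s` is output on a given instance, when all qubits of the final state are
measured in the computational basis and the outcome is handed to the (randomized, computationally
unbounded) classical post-processing `post`. -/
def QNCCircuit.outputProb {q : ℕ} (A : QNCCircuit n d q) (post : Bits q → PMF (Bits n))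
    (ρ₀ : Op q) (I : Data n d) (s : Bits n) : ℝ :=
  ∑ z, (A.run I ρ₀ z z).re * (post z s).toReal

/-- `Pr[s ← 𝒜^𝒪(ρ₀)]` over a random instance of the `d`-SCS problem of size `n`, the internal
randomness of the stochastic oracle, the measurement and the post-processing. -/
def QNCCircuit.successProb {q : ℕ} (A : QNCCircuit n d q) (post : Bits q → PMF (Bits n))
    (ρ₀ : Op q) : ℝ :=
  𝔼 f ∈ twoToOne n, 𝔼 gs ∈ simonPairs n, 𝔼 h : Equiv.Perm (Bits n),
    𝔼 t : Fin d → (Bits n ↪ Bits (n + n)),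
      A.outputProb post ρ₀ { f := f, g := gs.1, h := h, t := t } gs.2

end

/-- A function `ℕ → ℕ` that is bounded by a polynomial. -/
def PolyBounded (q : ℕ → ℕ) : Prop := ∃ P : Polynomial ℕ, ∀ n, q n ≤ P.eval n

/-- A negligible function: one that tends to zero faster than every inverse polynomial. -/
def Negligible (ε : ℕ → ℝ) : Prop :=
  Asymptotics.SuperpolynomialDecay atTop (fun n : ℕ => (n : ℝ)) ε

end SCS

/-!
The circuit makes only `d` rounds of queries, while evaluating `h` by means of the `d`-Shuffler
takes `d + 1` sequential ones. Hence it never learns a value of `h`, the oracles `p'` and `p'_inv`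
return `⊥` on all that it can ask, and nothing else depends on the Simon's function.

This is made precise by a hybrid argument. In round `i`, counted from `0`, the oracles are replaced
by shadows (`Data.shadowAnswer`) in which `f_j` for `j > i`, `p'` and `p'_inv` always return `⊥`.
The state that the shadows produce before round `i` depends only on `f`, on the samples of the
stochastic oracle and on `t₀, …, t_{i-1}`. On the other hand, a query distinguishes the oracles of
round `i` from their shadows only if it contains an element of some `t_k` with `k ≥ i`, or a value
of `h` at a point determined by `f` and `g`. These are independent of the state, so that each query
does so with probability at most `2⁻ⁿ` (`expect_answer_ne_shadowAnswer`). At most `q` queries fit on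
`q` qubits, and replacing the rounds one by one shows that the final state moves by at most
`4 d² q / 2ⁿ` in mean square (`QNCCircuit.expect_norm_evolve_sub_sq_le`). As `‖a‖²` is at most
`2 ‖b‖² + 2 ‖a - b‖²`, the success probability is at most twice the one with the shadow oracles plus
twice this error. With the shadow oracles, the output is independent of the Simon's function, whose
period is uniform over the `2ⁿ - 1` nonzero strings (`expect_guess_le`). The outcome is the bound
`(4 + 8 d² q) / 2ⁿ` of `QNCCircuit.successProb_le`.

Mixed states are handled by writing the density matrix as `B * Bᴴ`: operators act on `B` from the
left, and the squared Frobenius norm of `B` is the trace of the density matrix. The samples of the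
stochastic oracle are drawn in advance (`QNCCircuit.run_eq_expect`), so that all operators are
unitary.
-/

namespace SCS

/-! ### Resampling and hitting probabilities -/

/-- Resampling one coordinate: if `G a y` does not depend on the `k`-th coordinate of `y`, an
independent sample `a` of that coordinate may be replaced by `y k` itself. -/
lemma expect_resample {ι : Type*} [Fintype ι] [DecidableEq ι] {α : ι → Type*}
    {M : Type*} [AddCommMonoid M] [Module ℚ≥0 M] (s : ∀ i, Finset (α i)) (k : ι)
    (G : α k → (∀ i, α i) → M) (hG : ∀ a y b, G a (Function.update y k b) = G a y) :
    𝔼 a ∈ s k, 𝔼 y ∈ Fintype.piFinset s, G a y = 𝔼 y ∈ Fintype.piFinset s, G (y k) y := by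
  rcases (s k).eq_empty_or_nonempty with h | h
  · rw [h, Fintype.piFinset_eq_empty.mpr ⟨k, h⟩]
    simp
  have hmem : ∀ x ∈ s k ×ˢ Fintype.piFinset s,
      (x.2 k, Function.update x.2 k x.1) ∈ s k ×ˢ Fintype.piFinset s := by
    simp only [Finset.mem_product, Fintype.mem_piFinset]
    rintro ⟨a, y⟩ ⟨ha, hy⟩
    refine ⟨hy k, fun i => ?_⟩
    rcases eq_or_ne i k with rfl | hi
    · simpa using ha
    · simpa [hi] using hy i
  calc 𝔼 a ∈ s k, 𝔼 y ∈ Fintype.piFinset s, G a y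
      = 𝔼 x ∈ s k ×ˢ Fintype.piFinset s, G x.1 x.2 := by rw [Finset.expect_product]
    _ = 𝔼 x ∈ s k ×ˢ Fintype.piFinset s, G (x.2 k) x.2 := by
        -- exchanging `a` with the `k`-th coordinate of `y` is an involution
        refine Finset.expect_nbij' (fun x => (x.2 k, Function.update x.2 k x.1))
          (fun x => (x.2 k, Function.update x.2 k x.1)) hmem hmem ?_ ?_ ?_
        · rintro ⟨a, y⟩ _
          simp
        · rintro ⟨a, y⟩ _
          simp
        · rintro ⟨a, y⟩ _
          simp [hG]
    _ = 𝔼 y ∈ Fintype.piFinset s, G (y k) y := by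
        rw [Finset.expect_product]
        exact Finset.expect_const h (𝔼 y ∈ Fintype.piFinset s, G (y k) y)

/-- A uniformly random element of a set on which all permutations of `β` act hits a given value
with probability `1 / |β|`. -/
lemma expect_hit {T β : Type*} [Fintype T] [Fintype β] [DecidableEq β] (ev : T → β)
    (act : Equiv.Perm β → Equiv.Perm T) (hact : ∀ σ t, ev (act σ t) = σ (ev t)) (u : β) :
    (𝔼 t : T, if ev t = u then (1 : ℝ) else 0) ≤ 1 / Fintype.card β := by
  have hsym : ∀ u', (𝔼 t : T, if ev t = u' then (1 : ℝ) else 0)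
      = 𝔼 t : T, if ev t = u then (1 : ℝ) else 0 := fun u' => by
    refine Fintype.expect_equiv (act (Equiv.swap u' u)) _ _ fun t => ?_
    rw [hact]
    have : (Equiv.swap u' u (ev t) = u) ↔ ev t = u' := by
      rw [Equiv.swap_apply_eq_iff, Equiv.swap_apply_right]
    simp only [this]
  have hsum : ∑ u', (𝔼 t : T, if ev t = u' then (1 : ℝ) else 0) ≤ 1 := by
    rw [← Finset.expect_sum_comm]
    simp only [Finset.sum_ite_eq, Finset.mem_univ, if_true]
    rcases isEmpty_or_nonempty T with h | h
    · simp
    · rw [Fintype.expect_one]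
  rw [Finset.sum_congr rfl fun u' _ => hsym u', Finset.sum_const, Finset.card_univ,
    nsmul_eq_mul] at hsum
  have : 0 < (Fintype.card β : ℝ) := by exact_mod_cast Fintype.card_pos_iff.mpr ⟨u⟩
  rw [le_div_iff₀ this]
  linarith

lemma expect_perm_hit {n : ℕ} (c a : Bits n) :
    (𝔼 h : Equiv.Perm (Bits n), if h c = a then (1 : ℝ) else 0) ≤ 1 / 2 ^ n := by
  refine (expect_hit (fun h : Equiv.Perm (Bits n) => h c) (fun σ => Equiv.mulLeft σ)
    (fun σ t => rfl) a).trans_eq ?_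
  simp

/-- A given string of length `2n` lies in the range of a random injection from the strings of length
`n` with probability `2^n / 2^(2n)`. -/
lemma expect_embedding_hit {n : ℕ} (u : Bits (n + n)) :
    (𝔼 e : Bits n ↪ Bits (n + n), if ∃ x, e x = u then (1 : ℝ) else 0) ≤ 1 / 2 ^ n := by
  classical
  have key : ∀ x : Bits n, (𝔼 e : Bits n ↪ Bits (n + n), if e x = u then (1 : ℝ) else 0)
      ≤ 1 / 2 ^ (n + n) := fun x => by
    refine (expect_hit (fun e : Bits n ↪ Bits (n + n) => e x)
      (fun σ => Equiv.embeddingCongr (Equiv.refl _) σ) (fun σ t => rfl) u).trans_eq ?_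
    simp
  calc (𝔼 e : Bits n ↪ Bits (n + n), if ∃ x, e x = u then (1 : ℝ) else 0)
      ≤ 𝔼 e : Bits n ↪ Bits (n + n), ∑ x, if e x = u then (1 : ℝ) else 0 := by
        refine Finset.expect_le_expect fun e _ => ?_
        split_ifs with h
        · obtain ⟨x, hx⟩ := h
          refine le_trans (by simp [hx]) (Finset.single_le_sum (f := fun x =>
            if e x = u then (1 : ℝ) else 0) (fun i _ => by positivity) (Finset.mem_univ x))
        · positivity
    _ = ∑ x, 𝔼 e : Bits n ↪ Bits (n + n), if e x = u then (1 : ℝ) else 0 :=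
        Finset.expect_sum_comm _ _ _
    _ ≤ ∑ _x : Bits n, 1 / 2 ^ (n + n) := Finset.sum_le_sum fun x _ => key x
    _ = 1 / 2 ^ n := by
        simp [pow_add]

/-! ### Factors of density matrices and the Frobenius norm -/

section DensityFactor

open scoped MatrixOrder Matrix.Norms.L2Operator

lemma exists_eq_mul_conjTranspose {q : ℕ} {ρ : Op q} (hρ : ρ.PosSemidef) :
    ∃ B : Op q, ρ = B * Bᴴ := by
  obtain ⟨B, hB⟩ := CStarAlgebra.nonneg_iff_eq_star_mul_self.mp hρ.nonneg
  exact ⟨Bᴴ, by rw [hB, Matrix.conjTranspose_conjTranspose, Matrix.star_eq_conjTranspose]⟩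

end DensityFactor

open scoped Matrix.Norms.Frobenius

variable {q : ℕ}

lemma frobenius_sq (M : Op q) : ‖M‖ ^ 2 = ∑ z, ∑ w, ‖M z w‖ ^ 2 := by
  rw [Matrix.frobenius_norm_def, ← Real.sqrt_eq_rpow, Real.sq_sqrt (by positivity)]
  simp

lemma mul_conjTranspose_diag (M : Op q) (z : Bits q) :
    ((M * Mᴴ) z z).re = ∑ w, ‖M z w‖ ^ 2 := by
  rw [Matrix.mul_apply, Complex.re_sum]
  refine Finset.sum_congr rfl fun w _ => ?_
  rw [Matrix.conjTranspose_apply, Complex.star_def, Complex.mul_conj, Complex.normSq_eq_norm_sq,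
    Complex.ofReal_re]

lemma frobenius_sq_eq_trace (M : Op q) : ‖M‖ ^ 2 = (M * Mᴴ).trace.re := by
  rw [frobenius_sq, Matrix.trace, Complex.re_sum]
  exact Finset.sum_congr rfl fun z _ => (mul_conjTranspose_diag M z).symm

lemma frobenius_isometry_mul {U : Op q} (hU : Uᴴ * U = 1) (M : Op q) : ‖U * M‖ = ‖M‖ := by
  rw [← sq_eq_sq₀ (norm_nonneg _) (norm_nonneg _), frobenius_sq_eq_trace, frobenius_sq_eq_trace,
    Matrix.trace_mul_comm, Matrix.conjTranspose_mul, Matrix.mul_assoc, ← Matrix.mul_assoc Uᴴ, hU,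
    Matrix.one_mul, Matrix.trace_mul_comm]

/-! ### Layers of gates and rounds of queries are isometries -/

lemma GateLayer.conjTranspose_mul_self (L : GateLayer q) : L.unitaryᴴ * L.unitary = 1 := by
  classical
  ext a b
  rw [Matrix.mul_apply]
  let glue : (∀ j, Bits (L.arity j)) → Bits q := fun v =>
    Function.extend L.wire (fun p => v p.1 p.2) a
  have glue_wire : ∀ v j x, glue v (L.wire ⟨j, x⟩) = v j x := fun v j x =>
    L.wire.injective.extend_apply _ _ _
  have glue_off : ∀ v w, w ∉ Set.range L.wire → glue v w = a w := fun v w hw =>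
    Function.extend_apply' _ _ _ fun ⟨x, hx⟩ => hw ⟨x, hx⟩
  have glue_inj : Function.Injective glue := fun v v' h => by
    funext j x
    rw [← glue_wire v, ← glue_wire v', h]
  -- only the basis states that agree with `a` off the wires contribute
  rw [← Fintype.sum_of_injective glue glue_inj
    (fun v => L.unitaryᴴ a (glue v) * L.unitary (glue v) b) _ ?_ fun v => rfl]
  · by_cases hab : ∀ w, w ∉ Set.range L.wire → a w = b w
    · have hterm : ∀ v, L.unitaryᴴ a (glue v) * L.unitary (glue v) b
          = ∏ j, (star ((L.gate j : Matrix _ _ ℂ) (v j) fun x => a (L.wire ⟨j, x⟩))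
            * (L.gate j : Matrix _ _ ℂ) (v j) fun x => b (L.wire ⟨j, x⟩)) := fun v => by
        have h1 : ∀ w, w ∉ Set.range L.wire → glue v w = a w := glue_off v
        have h2 : ∀ w, w ∉ Set.range L.wire → glue v w = b w := fun w hw =>
          (glue_off v w hw).trans (hab w hw)
        rw [Matrix.conjTranspose_apply, GateLayer.unitary, GateLayer.unitary, if_pos h1, if_pos h2,
          star_prod, ← Finset.prod_mul_distrib]
        simp only [glue_wire]
      rw [Finset.sum_congr rfl fun v _ => hterm v,
        ← Fintype.prod_sum (fun j (u : Bits (L.arity j)) =>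
          star ((L.gate j : Matrix _ _ ℂ) u fun x => a (L.wire ⟨j, x⟩))
            * (L.gate j : Matrix _ _ ℂ) u fun x => b (L.wire ⟨j, x⟩))]
      have hgate : ∀ j, ∑ u : Bits (L.arity j),
          star ((L.gate j : Matrix _ _ ℂ) u fun x => a (L.wire ⟨j, x⟩))
            * (L.gate j : Matrix _ _ ℂ) u (fun x => b (L.wire ⟨j, x⟩))
          = if (fun x => a (L.wire ⟨j, x⟩)) = fun x => b (L.wire ⟨j, x⟩) then 1 else 0 := by
        intro j
        have := congrFun (congrFun (Matrix.UnitaryGroup.star_mul_self (L.gate j))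
          fun x => a (L.wire ⟨j, x⟩)) fun x => b (L.wire ⟨j, x⟩)
        rw [Matrix.mul_apply, Matrix.one_apply] at this
        exact this
      rw [Finset.prod_congr rfl fun j _ => hgate j, Matrix.one_apply]
      by_cases h : a = b
      · simp [h]
      · rw [if_neg h]
        by_contra hne
        refine h (funext fun w => ?_)
        by_cases hw : w ∈ Set.range L.wire
        · obtain ⟨⟨j, x⟩, rfl⟩ := hw
          by_contra hx
          exact hne (Finset.prod_eq_zero (Finset.mem_univ j)
            (if_neg fun heq => hx (congrFun heq x)))
        · exact hab w hw
    · rw [Matrix.one_apply, if_neg (by rintro rfl; exact hab fun _ _ => rfl)]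
      refine Finset.sum_eq_zero fun v _ => ?_
      have : L.unitary (glue v) b = 0 := if_neg fun h => hab fun w hw => by
        rw [← glue_off v w hw, h w hw]
      rw [this, mul_zero]
  · intro z hz
    have : L.unitary z a = 0 := if_neg fun h => by
      let v : ∀ j, Bits (L.arity j) := fun j x => z (L.wire ⟨j, x⟩)
      refine hz ⟨v, funext fun w => ?_⟩
      by_cases hw : w ∈ Set.range L.wire
      · obtain ⟨⟨j, x⟩, rfl⟩ := hw
        exact glue_wire v j x
      · exact (glue_off v w hw).trans (h w hw).symm
    rw [Matrix.conjTranspose_apply, this, star_zero, zero_mul]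

variable {n d : ℕ}

/-- The action `|x⟩|a⟩ ↦ |x⟩|a ⊕ F j x⟩` on basis states of a round of queries in which the `j`-th
query is answered by an arbitrary function `F j`. -/
def QueryLayer.actWith (L : QueryLayer n d q)
    (F : ∀ j, Bits ((L.kind j).inLen n) → Bits ((L.kind j).outLen n)) (z : Bits q) : Bits q :=
  fun w => z w + ∑ j, ∑ o, if L.wire ⟨j, Sum.inr o⟩ = w then
    F j (fun a => z (L.wire ⟨j, Sum.inl a⟩)) o else 0

lemma QueryLayer.actWith_involutive (L : QueryLayer n d q)
    (F : ∀ j, Bits ((L.kind j).inLen n) → Bits ((L.kind j).outLen n)) :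
    Function.Involutive (L.actWith F) := by
  intro z
  have hin : ∀ j a, L.actWith F z (L.wire ⟨j, Sum.inl a⟩) = z (L.wire ⟨j, Sum.inl a⟩) := by
    intro j a
    rw [QueryLayer.actWith, add_eq_left]
    refine Finset.sum_eq_zero fun j' _ => Finset.sum_eq_zero fun o _ => if_neg fun h => ?_
    have := L.wire.injective h
    simp only [Sigma.mk.injEq] at this
    obtain ⟨rfl, h'⟩ := this
    simp at h'
  funext w
  rw [QueryLayer.actWith]
  simp only [hin]
  rw [QueryLayer.actWith, add_assoc, CharTwo.add_self_eq_zero, add_zero]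

/-- The permutation operator of a round of queries answered by arbitrary functions. -/
def QueryLayer.unitaryWith (L : QueryLayer n d q)
    (F : ∀ j, Bits ((L.kind j).inLen n) → Bits ((L.kind j).outLen n)) : Op q :=
  fun z z' => if z = L.actWith F z' then 1 else 0

lemma QueryLayer.conjTranspose_mul_self (L : QueryLayer n d q)
    (F : ∀ j, Bits ((L.kind j).inLen n) → Bits ((L.kind j).outLen n)) :
    (L.unitaryWith F)ᴴ * L.unitaryWith F = 1 := by
  ext a b
  simp only [Matrix.mul_apply, Matrix.conjTranspose_apply, QueryLayer.unitaryWith, Matrix.one_apply]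
  simp [(L.actWith_involutive F).injective.eq_iff, eq_comm]

/-! ### Evolution of the factor of the density matrix -/

/-- The state of the circuit after `k` rounds of queries when the `i`-th round acts by the operator
`O i`. The state is represented by a matrix `B` for which the density matrix is `B * Bᴴ`. -/
noncomputable def QNCCircuit.evolve (A : QNCCircuit n d q) (O : Fin d → Op q) (B : Op q)
    (k : Fin (d + 1)) : Op q :=
  Fin.induction (motive := fun _ => Op q) ((A.gates 0).unitary * B)
    (fun i M => (A.gates i.succ).unitary * (O i * M)) k

lemma QNCCircuit.evolve_zero (A : QNCCircuit n d q) (O : Fin d → Op q) (B : Op q) :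
    A.evolve O B 0 = (A.gates 0).unitary * B := rfl

lemma QNCCircuit.evolve_succ (A : QNCCircuit n d q) (O : Fin d → Op q) (B : Op q) (i : Fin d) :
    A.evolve O B i.succ = (A.gates i.succ).unitary * (O i * A.evolve O B i.castSucc) := rfl

lemma QNCCircuit.evolve_congr (A : QNCCircuit n d q) {O O' : Fin d → Op q} (B : Op q)
    (k : Fin (d + 1)) (h : ∀ i : Fin d, i.castSucc < k → O i = O' i) :
    A.evolve O B k = A.evolve O' B k := by
  induction k using Fin.induction with
  | zero => rfl
  | succ i ih =>
    rw [evolve_succ, evolve_succ, h i i.castSucc_lt_succ,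
      ih fun j hj => h j (hj.trans i.castSucc_lt_succ)]

lemma QNCCircuit.norm_evolve (A : QNCCircuit n d q) {O : Fin d → Op q}
    (hO : ∀ i, (O i)ᴴ * O i = 1) (B : Op q) (k : Fin (d + 1)) : ‖A.evolve O B k‖ = ‖B‖ := by
  induction k using Fin.induction with
  | zero => rw [evolve_zero, frobenius_isometry_mul (GateLayer.conjTranspose_mul_self _)]
  | succ i ih =>
    rw [evolve_succ, frobenius_isometry_mul (GateLayer.conjTranspose_mul_self _),
      frobenius_isometry_mul (hO i), ih]

/-- The possible values of all samples drawn by the stochastic oracle in a run of the circuit. -/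
noncomputable def QNCCircuit.samples (A : QNCCircuit n d q) (f : Bits n → Bits n) :
    Finset (∀ i, Fin (A.queries i).num → Bits n) :=
  Fintype.piFinset fun _ => Fintype.piFinset fun _ => Finset.univ.image f

/-- All samples of the stochastic oracle may be drawn in advance: the final state is the average
over them of the final states of unitary circuits. -/
lemma QNCCircuit.run_eq_expect (A : QNCCircuit n d q) (I : Data n d) (B : Op q) :
    A.run I (B * Bᴴ) = 𝔼 y ∈ A.samples I.f,
      A.evolve (fun i => (A.queries i).unitary I (y i)) B (Fin.last d) *
        (A.evolve (fun i => (A.queries i).unitary I (y i)) B (Fin.last d))ᴴ := by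
  classical
  have hne : (A.samples I.f).Nonempty :=
    Fintype.piFinset_nonempty.mpr fun _ => Fintype.piFinset_nonempty.mpr fun _ =>
      Finset.univ_nonempty.image _
  rw [QNCCircuit.run]
  generalize Fin.last d = k
  induction k using Fin.induction with
  | zero =>
    simp only [Fin.induction_zero, evolve_zero]
    rw [Finset.expect_const hne, Matrix.conjTranspose_mul]
    simp only [Matrix.mul_assoc]
  | succ i ih =>
    rw [Fin.induction_succ, ih, QueryLayer.channel]
    simp only [evolve_succ]
    rw [Finset.mul_expect, Finset.expect_mul]
    simp only [Finset.mul_expect, Finset.expect_mul]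
    have := expect_resample
      (fun i : Fin d => Fintype.piFinset fun _ : Fin (A.queries i).num => Finset.univ.image I.f) i
      (fun a y => (A.gates i.succ).unitary * ((A.queries i).unitary I a *
          A.evolve (fun i => (A.queries i).unitary I (y i)) B i.castSucc) *
        ((A.gates i.succ).unitary * ((A.queries i).unitary I a *
          A.evolve (fun i => (A.queries i).unitary I (y i)) B i.castSucc))ᴴ) ?_
    · rw [QNCCircuit.samples, ← this]
      refine Finset.expect_congr rfl fun a _ => Finset.expect_congr rfl fun y _ => ?_
      simp only [Matrix.conjTranspose_mul, Matrix.mul_assoc]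
    · intro a y b
      have : A.evolve (fun j => (A.queries j).unitary I (Function.update y i b j)) B i.castSucc
          = A.evolve (fun j => (A.queries j).unitary I (y j)) B i.castSucc :=
        A.evolve_congr B _ fun j hj => by
          rw [Function.update_of_ne (by rintro rfl; exact lt_irrefl _ hj)]
      simp only [this]

lemma QNCCircuit.outputProb_eq_expect (A : QNCCircuit n d q) (post : Bits q → PMF (Bits n))
    (I : Data n d) (B : Op q) (s : Bits n) :
    A.outputProb post (B * Bᴴ) I s = 𝔼 y ∈ A.samples I.f, ∑ z, (∑ w,
      ‖A.evolve (fun i => (A.queries i).unitary I (y i)) B (Fin.last d) z w‖ ^ 2)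
        * (post z s).toReal := by
  rw [QNCCircuit.outputProb, Finset.expect_sum_comm]
  refine Finset.sum_congr rfl fun z _ => ?_
  rw [← Finset.expect_mul, run_eq_expect]
  congr 1
  simp only [← mul_conjTranspose_diag]
  simp [Finset.expect, Matrix.sum_apply, Complex.smul_re]

/-! ### The hybrid argument -/

/-- Replacing the rounds of queries one after the other, starting from the last one: the `i`-th
replacement is felt only by the state that the substitute operators produce before round `i`. -/
lemma QNCCircuit.norm_evolve_sub_le (A : QNCCircuit n d q) {O S : Fin d → Op q}
    (hO : ∀ i, (O i)ᴴ * O i = 1) (B : Op q) (k : Fin (d + 1)) :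
    ‖A.evolve O B k - A.evolve S B k‖
      ≤ ∑ i : Fin d with i.castSucc < k, ‖(O i - S i) * A.evolve S B i.castSucc‖ := by
  induction k using Fin.induction with
  | zero => simp [evolve_zero]
  | succ i ih =>
    have hset : (Finset.univ.filter fun j : Fin d => j.castSucc < i.succ)
        = insert i (Finset.univ.filter fun j : Fin d => j.castSucc < i.castSucc) := by
      ext j
      simp only [Finset.mem_filter, Finset.mem_univ, true_and, Finset.mem_insert, Fin.lt_def,
        Fin.ext_iff, Fin.val_castSucc, Fin.val_succ]
      omega
    rw [hset, Finset.sum_insert (by simp), evolve_succ, evolve_succ, ← mul_sub,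
      frobenius_isometry_mul (GateLayer.conjTranspose_mul_self _)]
    have : O i * A.evolve O B i.castSucc - S i * A.evolve S B i.castSucc
        = (O i - S i) * A.evolve S B i.castSucc
          + O i * (A.evolve O B i.castSucc - A.evolve S B i.castSucc) := by
      rw [sub_mul, mul_sub]
      abel
    rw [this]
    refine (norm_add_le _ _).trans (add_le_add le_rfl ?_)
    rw [frobenius_isometry_mul (hO i)]
    exact ih

lemma QNCCircuit.norm_evolve_sub_sq_le (A : QNCCircuit n d q) {O S : Fin d → Op q}
    (hO : ∀ i, (O i)ᴴ * O i = 1) (B : Op q) :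
    ‖A.evolve O B (Fin.last d) - A.evolve S B (Fin.last d)‖ ^ 2
      ≤ d * ∑ i, ‖(O i - S i) * A.evolve S B i.castSucc‖ ^ 2 := by
  have h := A.norm_evolve_sub_le (S := S) hO B (Fin.last d)
  rw [Finset.filter_true_of_mem fun i _ => i.castSucc_lt_last] at h
  refine (pow_le_pow_left₀ (norm_nonneg _) h 2).trans ?_
  simpa using sq_sum_le_card_mul_sum_sq (s := (Finset.univ : Finset (Fin d)))
    (f := fun i => ‖(O i - S i) * A.evolve S B i.castSucc‖)

/-- Two rounds of queries differ on a state by at most the weight of the basis states in which some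
query is answered differently. -/
lemma QueryLayer.norm_unitaryWith_sub_mul_sq_le (L : QueryLayer n d q)
    (F F' : ∀ j, Bits ((L.kind j).inLen n) → Bits ((L.kind j).outLen n)) (M : Op q) :
    ‖(L.unitaryWith F - L.unitaryWith F') * M‖ ^ 2 ≤ 4 * ∑ j, ∑ z,
      (if F j (fun a => z (L.wire ⟨j, Sum.inl a⟩)) ≠ F' j (fun a => z (L.wire ⟨j, Sum.inl a⟩))
        then 1 else 0) * ∑ w, ‖M z w‖ ^ 2 := by
  classical
  let bad : Bits q → Prop := fun z => ∃ j,
    F j (fun a => z (L.wire ⟨j, Sum.inl a⟩)) ≠ F' j (fun a => z (L.wire ⟨j, Sum.inl a⟩))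
  let N : Op q := fun z w => if bad z then M z w else 0
  have hN : (L.unitaryWith F - L.unitaryWith F') * M
      = L.unitaryWith F * N - L.unitaryWith F' * N := by
    rw [← sub_mul]
    ext z w
    rw [Matrix.mul_apply, Matrix.mul_apply]
    refine Finset.sum_congr rfl fun z' _ => ?_
    by_cases hz : bad z'
    · simp only [N, if_pos hz]
    · have hact : L.actWith F z' = L.actWith F' z' := by
        simp only [bad, not_exists, not_not] at hz
        funext w
        simp only [QueryLayer.actWith, hz]
      rw [Matrix.sub_apply, QueryLayer.unitaryWith, QueryLayer.unitaryWith, hact, sub_self,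
        zero_mul, zero_mul]
  have hle : ‖(L.unitaryWith F - L.unitaryWith F') * M‖ ≤ 2 * ‖N‖ := by
    rw [hN]
    refine (norm_sub_le _ _).trans_eq ?_
    rw [frobenius_isometry_mul (L.conjTranspose_mul_self F),
      frobenius_isometry_mul (L.conjTranspose_mul_self F'), two_mul]
  refine (pow_le_pow_left₀ (norm_nonneg _) hle 2).trans ?_
  rw [mul_pow, Finset.sum_comm, frobenius_sq]
  norm_num only
  refine mul_le_mul_of_nonneg_left (Finset.sum_le_sum fun z _ => ?_) (by norm_num)
  rw [← Finset.sum_mul]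
  by_cases hz : bad z
  · simp only [N, if_pos hz]
    refine le_mul_of_one_le_left (by positivity) ?_
    obtain ⟨j, hj⟩ := hz
    refine le_trans (by rw [if_pos hj]) (Finset.single_le_sum (f := fun j => if
      F j (fun a => z (L.wire ⟨j, Sum.inl a⟩)) ≠ F' j (fun a => z (L.wire ⟨j, Sum.inl a⟩))
      then (1 : ℝ) else 0) (fun i _ => by positivity) (Finset.mem_univ j))
  · simp only [N, if_neg hz]
    simp only [norm_zero, ne_eq, OfNat.ofNat_ne_zero, not_false_eq_true, zero_pow,
      Finset.sum_const_zero]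
    positivity

/-! ### Shadow oracles -/

/-- The answers of the shadow oracles of round `i` (counted from `0`): the stochastic oracle and
the shuffler functions `f₀, …, f_i` answer truthfully, all others always return `⊥`. -/
noncomputable def Data.shadowAnswer (I : Data n d) (i : Fin d) (y : Bits n) :
    (k : SubOracle d) → Bits (k.inLen n) → Bits (k.outLen n)
  | .stoch, b => I.answer y .stoch b
  | .shuffler j, v => if j.val ≤ i.val then I.answer y (.shuffler j) v else encodeBot none
  | .enc, _ => encodeBot none
  | .encInv, _ => encodeBot none

lemma Data.shadowAnswer_of_le (I : Data n d) {i : Fin d} {j : Fin (d + 1)} (hj : j.val ≤ i.val)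
    (y : Bits n) : I.shadowAnswer i y (.shuffler j) = I.answer y (.shuffler j) :=
  funext fun _ => if_pos hj

lemma Data.shadowAnswer_of_not_le (I : Data n d) {i : Fin d} {j : Fin (d + 1)}
    (hj : ¬ j.val ≤ i.val) (y : Bits n) :
    I.shadowAnswer i y (.shuffler j) = fun _ => encodeBot none :=
  funext fun _ => if_neg hj

lemma Data.tuples_succ (I : Data n d) (j : Fin (d + 2)) (k : Fin d) (hj : j.val = k.val + 1) :
    I.tuples j = I.t k := by
  have : j = k.castSucc.succ := Fin.ext (by simpa using hj)
  rw [this, Data.tuples, Fin.cons_succ, Fin.snoc_castSucc]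

lemma Data.tuples_congr {I I' : Data n d} (i : Fin d) (ht : ∀ k ≤ i, I.t k = I'.t k)
    (j : Fin (d + 2)) (hj : j.val ≤ i.val + 1) : I.tuples j = I'.tuples j := by
  rcases Nat.eq_zero_or_pos j.val with h0 | h0
  · obtain rfl : j = 0 := Fin.ext h0
    rfl
  · have hk : j.val - 1 ≤ i.val := by omega
    have hj' : j.val = (⟨j.val - 1, hk.trans_lt i.isLt⟩ : Fin d).val + 1 := by
      simp only
      omega
    rw [I.tuples_succ j _ hj', I'.tuples_succ j _ hj', ht _ hk]

/-- The shadow oracles of round `i` depend on `f` and `t₀, …, t_i` only. -/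
lemma Data.shadowAnswer_congr {I I' : Data n d} (i : Fin d) (hf : I.f = I'.f)
    (ht : ∀ k ≤ i, I.t k = I'.t k) (y : Bits n) (k : SubOracle d) :
    I.shadowAnswer i y k = I'.shadowAnswer i y k := by
  cases k with
  | stoch =>
    funext b
    simp only [Data.shadowAnswer, Data.answer]
    rw [hf]
  | shuffler j =>
    by_cases hj : j.val ≤ i.val
    · rw [Data.shadowAnswer_of_le _ hj, Data.shadowAnswer_of_le _ hj]
      funext v
      simp only [Data.answer, Data.shuffler]
      rw [Data.tuples_congr i ht j.castSucc (by simp only [Fin.val_castSucc]; omega),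
        Data.tuples_congr i ht j.succ (by simp only [Fin.val_succ]; omega)]
    · rw [Data.shadowAnswer_of_not_le _ hj, Data.shadowAnswer_of_not_le _ hj]
  | enc => rfl
  | encInv => rfl

/-- The operator of the shadow oracles in round `i`. -/
noncomputable def QNCCircuit.shadowOp (A : QNCCircuit n d q) (I : Data n d)
    (y : ∀ i, Fin (A.queries i).num → Bits n) (i : Fin d) : Op q :=
  (A.queries i).unitaryWith fun j => I.shadowAnswer i (y i j) ((A.queries i).kind j)

lemma QNCCircuit.evolve_shadowOp_congr (A : QNCCircuit n d q) {I I' : Data n d}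
    (y : ∀ i, Fin (A.queries i).num → Bits n) (B : Op q) (k : Fin (d + 1)) (hf : I.f = I'.f)
    (ht : ∀ i : Fin d, i.castSucc < k → I.t i = I'.t i) :
    A.evolve (A.shadowOp I y) B k = A.evolve (A.shadowOp I' y) B k := by
  refine A.evolve_congr B k fun i hi => ?_
  simp only [QNCCircuit.shadowOp]
  congr 1
  funext j
  exact Data.shadowAnswer_congr i hf
    (fun k' hk' => ht k' (lt_of_le_of_lt (Fin.castSucc_le_castSucc_iff.mpr hk') hi)) _ _

lemma Data.exists_of_shuffler_ne (I : Data n d) (j : Fin (d + 1)) (k : Fin d)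
    (hjk : j.val = k.val + 1) (v : Option (Bits (n + n))) (h : I.shuffler j v ≠ none) :
    ∃ u, v = some u ∧ ∃ x, I.t k x = u := by
  cases v with
  | none => exact absurd rfl h
  | some u =>
    refine ⟨u, rfl, ?_⟩
    by_contra hx
    refine h ?_
    rw [Data.shuffler, I.tuples_succ j.castSucc k hjk, Option.bind_some, Function.partialInv,
      dif_neg hx, Option.map_none]

/-- In round `i`, a fixed query distinguishes the oracles from their shadows with probability at
most `2⁻ⁿ`, even when weighted by a quantity that does not depend on `h` and on `t_k` for `k ≥ i`:
the query has to contain a value of `h`, or an element of the tuple `t_k` for some `k ≥ i`. -/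
lemma expect_answer_ne_shadowAnswer (f g : Bits n → Bits n) (y : Bits n) (i : Fin d)
    (k : SubOracle d) (v : Bits (k.inLen n)) (X : (Fin d → (Bits n ↪ Bits (n + n))) → ℝ)
    (hX : ∀ t, 0 ≤ X t) (hXi : ∀ t k e, i ≤ k → X (Function.update t k e) = X t) :
    (𝔼 h : Equiv.Perm (Bits n), 𝔼 t : Fin d → (Bits n ↪ Bits (n + n)),
      (if (Data.mk f g h t).answer y k v ≠ (Data.mk f g h t).shadowAnswer i y k v
        then (1 : ℝ) else 0) * X t) ≤ 1 / 2 ^ n * 𝔼 t, X t := by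
  have hEX : 0 ≤ 𝔼 t, X t := Finset.expect_nonneg fun t _ => hX t
  -- queries that hit the value of `h` at a point determined by `f` and `g`
  have hperm : ∀ c a : Bits n, (∀ h t, (Data.mk f g h t).answer y k v
      ≠ (Data.mk f g h t).shadowAnswer i y k v → h c = a) →
      (𝔼 h : Equiv.Perm (Bits n), 𝔼 t : Fin d → (Bits n ↪ Bits (n + n)),
      (if (Data.mk f g h t).answer y k v ≠ (Data.mk f g h t).shadowAnswer i y k v
        then (1 : ℝ) else 0) * X t) ≤ 1 / 2 ^ n * 𝔼 t, X t := by
    intro c a hca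
    calc _ ≤ 𝔼 h : Equiv.Perm (Bits n), 𝔼 t, (if h c = a then (1 : ℝ) else 0) * X t := by
          refine Finset.expect_le_expect fun h _ => Finset.expect_le_expect fun t _ =>
            mul_le_mul_of_nonneg_right ?_ (hX t)
          by_cases hne : (Data.mk f g h t).answer y k v ≠ (Data.mk f g h t).shadowAnswer i y k v
          · rw [if_pos hne, if_pos (hca h t hne)]
          · rw [if_neg hne]
            positivity
      _ = (𝔼 h : Equiv.Perm (Bits n), if h c = a then (1 : ℝ) else 0) * 𝔼 t, X t := by
          rw [Finset.expect_mul]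
          simp only [Finset.mul_expect]
      _ ≤ _ := mul_le_mul_of_nonneg_right (expect_perm_hit c a) hEX
  cases k with
  | stoch =>
    simp only [Data.shadowAnswer, ne_eq, not_true_eq_false, if_false, zero_mul,
      Finset.expect_const_zero]
    positivity
  | enc =>
    refine hperm (f fun j => v (Fin.natAdd n j)) (fun j => v (Fin.castAdd n j)) fun h t hne => ?_
    by_contra hca
    exact hne (congrArg encodeBot (if_neg fun heq => hca (Eq.symm heq)))
  | encInv =>
    refine hperm (f ((csMap f g).symm fun j => v (Fin.natAdd n j)))
      (fun j => v (Fin.castAdd n j)) fun h t hne => ?_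
    by_contra hca
    exact hne (congrArg encodeBot (if_neg fun heq => hca (Eq.symm heq)))
  | shuffler j =>
    by_cases hj : j.val ≤ i.val
    · simp only [Data.shadowAnswer_of_le _ hj, ne_eq, not_true_eq_false, if_false, zero_mul,
        Finset.expect_const_zero]
      positivity
    · have hlt : j.val - 1 < d := by omega
      let k : Fin d := ⟨j.val - 1, hlt⟩
      have hjk : j.val = k.val + 1 := by simp only [k]; omega
      have hik : i ≤ k := by rw [Fin.le_def]; omega
      have hnone : ∀ h t, (Data.mk f g h t).answer y (.shuffler j) v
          ≠ (Data.mk f g h t).shadowAnswer i y (.shuffler j) v →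
          ∃ u, decodeBot v = some u ∧ ∃ x, t k x = u := by
        intro h t hne
        refine (Data.mk f g h t).exists_of_shuffler_ne j k hjk _ fun h0 => hne ?_
        rw [Data.shadowAnswer_of_not_le _ hj]
        exact congrArg encodeBot h0
      have hbound : ∀ h : Equiv.Perm (Bits n), (𝔼 t : Fin d → (Bits n ↪ Bits (n + n)),
          (if (Data.mk f g h t).answer y (.shuffler j) v
            ≠ (Data.mk f g h t).shadowAnswer i y (.shuffler j) v then (1 : ℝ) else 0) * X t)
          ≤ 1 / 2 ^ n * 𝔼 t, X t := by
        intro h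
        rcases hv : decodeBot v with _ | u
        · refine le_trans (Finset.expect_eq_zero fun t _ => ?_).le
            (mul_nonneg (by positivity) hEX)
          rw [if_neg, zero_mul]
          intro hne
          obtain ⟨u, hu, -⟩ := hnone h t hne
          rw [hv] at hu
          exact absurd hu (by simp)
        calc _ ≤ 𝔼 t, (if ∃ x, t k x = u then (1 : ℝ) else 0) * X t := by
              refine Finset.expect_le_expect fun t _ => mul_le_mul_of_nonneg_right ?_ (hX t)
              by_cases hne : (Data.mk f g h t).answer y (.shuffler j) v
                ≠ (Data.mk f g h t).shadowAnswer i y (.shuffler j) v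
              · obtain ⟨u', hu', hx⟩ := hnone h t hne
                rw [hv, Option.some.injEq] at hu'
                rw [if_pos hne, if_pos (hu' ▸ hx)]
              · rw [if_neg hne]
                positivity
          _ = 𝔼 e : Bits n ↪ Bits (n + n), 𝔼 t,
                (if ∃ x, e x = u then (1 : ℝ) else 0) * X t := by
              have := expect_resample
                (fun _ : Fin d => (Finset.univ : Finset (Bits n ↪ Bits (n + n)))) k
                (fun e t => (if ∃ x, e x = u then (1 : ℝ) else 0) * X t)
                (fun e t b => by simp only [hXi t k b hik])
              rw [Fintype.piFinset_univ] at this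
              exact this.symm
          _ = (𝔼 e : Bits n ↪ Bits (n + n), if ∃ x, e x = u then (1 : ℝ) else 0)
                * 𝔼 t, X t := by
              rw [Finset.expect_mul]
              simp only [Finset.mul_expect]
          _ ≤ _ := mul_le_mul_of_nonneg_right (expect_embedding_hit u) hEX
      exact Finset.expect_le Finset.univ_nonempty fun h _ => hbound h

lemma SubOracle.inLen_pos (hn : 0 < n) (k : SubOracle d) : 0 < k.inLen n := by
  cases k <;> simp only [SubOracle.inLen] <;> omega

/-- The query registers of a round are disjoint and nonempty. -/
lemma QueryLayer.num_le (hn : 0 < n) (L : QueryLayer n d q) : L.num ≤ q := by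
  have hinj : Function.Injective fun j : Fin L.num =>
      L.wire ⟨j, Sum.inl ⟨0, (L.kind j).inLen_pos hn⟩⟩ := fun j j' h => by
    have := L.wire.injective h
    simp only [Sigma.mk.injEq] at this
    exact this.1
  simpa using Fintype.card_le_of_injective _ hinj

/-- On average over `h` and the tuples of the shuffler, the final state does not change much when
all oracles are replaced by their shadows. -/
lemma QNCCircuit.expect_norm_evolve_sub_sq_le (hn : 0 < n) (A : QNCCircuit n d q)
    (f g : Bits n → Bits n) (y : ∀ i, Fin (A.queries i).num → Bits n) (B : Op q) :
    (𝔼 h : Equiv.Perm (Bits n), 𝔼 t : Fin d → (Bits n ↪ Bits (n + n)),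
      ‖A.evolve (fun i => (A.queries i).unitary ⟨f, g, h, t⟩ (y i)) B (Fin.last d)
        - A.evolve (A.shadowOp ⟨f, g, h, t⟩ y) B (Fin.last d)‖ ^ 2)
      ≤ 4 * d ^ 2 * q / 2 ^ n * ‖B‖ ^ 2 := by
  have hq : ∀ i, ((A.queries i).num : ℝ) ≤ q := fun i => by
    exact_mod_cast (A.queries i).num_le hn
  -- the shadow state does not depend on `h`; its values are taken at `h = 1`
  let St : (Fin d → (Bits n ↪ Bits (n + n))) → Fin (d + 1) → Op q := fun t k =>
    A.evolve (A.shadowOp ⟨f, g, 1, t⟩ y) B k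
  have hSt : ∀ h t k, A.evolve (A.shadowOp ⟨f, g, h, t⟩ y) B k = St t k := fun h t k =>
    A.evolve_shadowOp_congr y B k rfl fun _ _ => rfl
  let ind : ∀ (i : Fin d) (j : Fin (A.queries i).num), Bits q → Equiv.Perm (Bits n) →
      (Fin d → (Bits n ↪ Bits (n + n))) → ℝ := fun i j z h t =>
    if (Data.mk f g h t).answer (y i j) ((A.queries i).kind j)
        (fun a => z ((A.queries i).wire ⟨j, Sum.inl a⟩))
      ≠ (Data.mk f g h t).shadowAnswer i (y i j) ((A.queries i).kind j)
        (fun a => z ((A.queries i).wire ⟨j, Sum.inl a⟩)) then 1 else 0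
  have hpoint : ∀ h t, ‖A.evolve (fun i => (A.queries i).unitary ⟨f, g, h, t⟩ (y i)) B (Fin.last d)
      - A.evolve (A.shadowOp ⟨f, g, h, t⟩ y) B (Fin.last d)‖ ^ 2
      ≤ d * ∑ i, 4 * ∑ j, ∑ z, ind i j z h t * ∑ w, ‖St t i.castSucc z w‖ ^ 2 := by
    intro h t
    refine (A.norm_evolve_sub_sq_le (fun i => (A.queries i).conjTranspose_mul_self _) B).trans
      (mul_le_mul_of_nonneg_left (Finset.sum_le_sum fun i _ => ?_) (Nat.cast_nonneg _))
    rw [hSt]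
    exact (A.queries i).norm_unitaryWith_sub_mul_sq_le _ _ _
  have hterm : ∀ (i : Fin d) (j : Fin (A.queries i).num) (z : Bits q),
      (𝔼 h, 𝔼 t, ind i j z h t * ∑ w, ‖St t i.castSucc z w‖ ^ 2)
      ≤ 1 / 2 ^ n * 𝔼 t, ∑ w, ‖St t i.castSucc z w‖ ^ 2 := by
    intro i j z
    refine expect_answer_ne_shadowAnswer f g (y i j) i ((A.queries i).kind j) _ _
      (fun t => by positivity) fun t k e hik => ?_
    have : St (Function.update t k e) i.castSucc = St t i.castSucc :=
      A.evolve_shadowOp_congr y B _ rfl fun i' hi' => by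
        refine Function.update_of_ne ?_ _ _
        rintro rfl
        exact absurd hik (not_le.mpr hi')
    rw [this]
  have hmass : ∀ i : Fin d, ∑ z, (𝔼 t, ∑ w, ‖St t i.castSucc z w‖ ^ 2) = ‖B‖ ^ 2 := by
    intro i
    have hnorm : ∀ t, ‖St t i.castSucc‖ = ‖B‖ := fun t =>
      A.norm_evolve (fun i => (A.queries i).conjTranspose_mul_self _) B i.castSucc
    have he : Function.Injective fun x : Bits n => (Fin.append 0 x : Bits (n + n)) :=
      fun x x' h => funext fun j => (Fin.append_right 0 x j).symm.trans
        ((congrFun h (Fin.natAdd n j)).trans (Fin.append_right 0 x' j))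
    have : Nonempty (Fin d → (Bits n ↪ Bits (n + n))) := ⟨fun _ => ⟨_, he⟩⟩
    rw [← Finset.expect_sum_comm]
    simp only [← frobenius_sq, hnorm]
    exact Fintype.expect_const _
  calc _ ≤ 𝔼 h, 𝔼 t, (d : ℝ) * ∑ i, 4 * ∑ j, ∑ z, ind i j z h t
        * ∑ w, ‖St t i.castSucc z w‖ ^ 2 :=
        Finset.expect_le_expect fun h _ => Finset.expect_le_expect fun t _ => hpoint h t
    _ = d * ∑ i, 4 * ∑ j, ∑ z, 𝔼 h, 𝔼 t, ind i j z h t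
        * ∑ w, ‖St t i.castSucc z w‖ ^ 2 := by
        simp only [← Finset.mul_expect, Finset.expect_sum_comm]
    _ ≤ d * ∑ i, 4 * ∑ _j : Fin (A.queries i).num, 1 / 2 ^ n * ‖B‖ ^ 2 := by
        refine mul_le_mul_of_nonneg_left (Finset.sum_le_sum fun i _ =>
          mul_le_mul_of_nonneg_left (Finset.sum_le_sum fun j _ => ?_) (by norm_num))
          (Nat.cast_nonneg _)
        rw [← hmass i, Finset.mul_sum]
        exact Finset.sum_le_sum fun z _ => hterm i j z
    _ ≤ d * ∑ _i : Fin d, 4 * (q * (1 / 2 ^ n * ‖B‖ ^ 2)) := by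
        gcongr with i _
        rw [Finset.sum_const, Finset.card_univ, Fintype.card_fin, nsmul_eq_mul]
        exact mul_le_mul_of_nonneg_right (hq i) (by positivity)
    _ = 4 * d ^ 2 * q / 2 ^ n * ‖B‖ ^ 2 := by
        rw [Finset.sum_const, Finset.card_univ, Fintype.card_fin, nsmul_eq_mul]
        ring

/-! ### Guessing the period blindly -/

/-- The automorphisms of `{0,1}^n` act transitively on nonzero strings. A transvection
`x ↦ x + φ x • (s + s')` does the job, for a functional `φ` with `φ s = φ s' = 1`. -/
lemma exists_involutive_additive {s s' : Bits n} (hs : s ≠ 0) (hs' : s' ≠ 0) :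
    ∃ T : Bits n → Bits n, Function.Involutive T ∧ (∀ x y, T (x + y) = T x + T y) ∧ T s = s' := by
  have hone : ∀ a : ZMod 2, a ≠ 0 → a = 1 := by decide
  obtain ⟨φ, hs1, hs1'⟩ : ∃ φ : Bits n →ₗ[ZMod 2] ZMod 2, φ s = 1 ∧ φ s' = 1 := by
    obtain ⟨i, hi⟩ := Function.ne_iff.mp hs
    obtain ⟨j, hj⟩ := Function.ne_iff.mp hs'
    replace hi := hone _ hi
    replace hj := hone _ hj
    by_cases hi' : s' i = 0
    · by_cases hj' : s j = 0
      · refine ⟨(LinearMap.proj i : Bits n →ₗ[ZMod 2] ZMod 2) + LinearMap.proj j, ?_, ?_⟩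
        · change s i + s j = 1
          rw [hi, hj', add_zero]
        · change s' i + s' j = 1
          rw [hi', hj, zero_add]
      · exact ⟨LinearMap.proj j, hone _ hj', hj⟩
    · exact ⟨LinearMap.proj i, hi, hone _ hi'⟩
  have hss : φ (s + s') = 0 := by
    rw [map_add, hs1, hs1']
    decide
  have h2 : ∀ x : Bits n, x + x = 0 := fun x => funext fun i => CharTwo.add_self_eq_zero (x i)
  refine ⟨fun x => x + φ x • (s + s'), fun x => ?_, fun x y => ?_, ?_⟩
  · simp only [map_add, map_smul, hss, smul_zero, add_zero, add_assoc, h2]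
  · simp only [map_add, add_smul]
    abel
  · simp only [hs1, one_smul, ← add_assoc, h2, zero_add]

lemma IsTwoToOne.comp_involutive {g T : Bits n → Bits n} (hg : IsTwoToOne g)
    (hT : Function.Involutive T) : IsTwoToOne fun x => g (T x) := by
  intro x₀
  obtain ⟨x₁, ⟨hne, heq⟩, huniq⟩ := hg (T x₀)
  refine ⟨T x₁, ⟨fun h => hne ?_, by simpa only [hT x₁] using heq⟩, fun z ⟨hz, hgz⟩ => ?_⟩
  · rw [← h, hT x₁]
  · rw [← huniq (T z) ⟨fun h => hz (hT.injective h), hgz⟩, hT z]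

/-- The period of a random Simon's function is uniformly distributed over the nonzero strings. -/
lemma expect_period_eq_le (hn : 0 < n) (s : Bits n) :
    (𝔼 gs ∈ simonPairs n, if gs.2 = s then (1 : ℝ) else 0) ≤ 2 / 2 ^ n := by
  classical
  by_cases hs : s = 0
  · refine le_trans (Finset.expect_eq_zero fun gs hgs => if_neg ?_).le (by positivity)
    rw [hs]
    exact (Finset.mem_filter.mp hgs).2.2.1
  have hsym : ∀ s' ∈ ({0}ᶜ : Finset (Bits n)),
      (𝔼 gs ∈ simonPairs n, if gs.2 = s' then (1 : ℝ) else 0)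
        = 𝔼 gs ∈ simonPairs n, if gs.2 = s then (1 : ℝ) else 0 := by
    intro s' hs'
    obtain ⟨T, hT, hadd, hTs⟩ := exists_involutive_additive hs (by simpa using hs')
    have hT0 : ∀ x, T x ≠ 0 ↔ x ≠ 0 := fun x => by
      have h0 : T 0 = 0 := by simpa using hadd 0 0
      exact not_congr ⟨fun h => by rw [← hT x, h, h0], fun h => by rw [h, h0]⟩
    have hmem : ∀ gs ∈ simonPairs n,
        ((fun x => gs.1 (T x), T gs.2) : (Bits n → Bits n) × Bits n) ∈ simonPairs n := by
      intro gs hgs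
      obtain ⟨h1, h2, h3⟩ := (Finset.mem_filter.mp hgs).2
      refine Finset.mem_filter.mpr ⟨Finset.mem_univ _, h1.comp_involutive hT, (hT0 _).mpr h2,
        fun x => ?_⟩
      simp only [hadd, hT gs.2, h3]
    refine Finset.expect_nbij' (fun gs => (fun x => gs.1 (T x), T gs.2))
      (fun gs => (fun x => gs.1 (T x), T gs.2)) hmem hmem ?_ ?_ ?_
    · rintro ⟨g, r⟩ _
      simp only [hT _]
    · rintro ⟨g, r⟩ _
      simp only [hT _]
    · rintro ⟨g, r⟩ _
      have : r = s' ↔ T r = s := by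
        rw [← hTs]
        exact ⟨fun h => by rw [h, hT s], fun h => by rw [← h, hT r]⟩
      simp only [this]
  have hsum : ∑ s' ∈ ({0}ᶜ : Finset (Bits n)),
      (𝔼 gs ∈ simonPairs n, if gs.2 = s' then (1 : ℝ) else 0) ≤ 1 := by
    rw [← Finset.expect_sum_comm]
    rcases (simonPairs n).eq_empty_or_nonempty with h | h
    · simp [h]
    · refine Finset.expect_le h fun gs _ => ?_
      rw [Finset.sum_ite_eq]
      split_ifs <;> norm_num
  have hcard : (({0}ᶜ : Finset (Bits n)).card : ℝ) = 2 ^ n - 1 := by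
    rw [Finset.card_compl, Finset.card_singleton, Nat.cast_sub Fintype.card_pos]
    simp
  rw [Finset.sum_congr rfl hsym, Finset.sum_const, nsmul_eq_mul, hcard] at hsum
  have h2n : (2 : ℝ) ≤ 2 ^ n := by
    simpa using pow_le_pow_right₀ (one_le_two (α := ℝ)) hn
  have hnonneg : 0 ≤ 𝔼 gs ∈ simonPairs n, if gs.2 = s then (1 : ℝ) else 0 :=
    Finset.expect_nonneg fun _ _ => by positivity
  rw [le_div_iff₀ (by positivity)]
  nlinarith

/-- A guess made independently of the Simon's function is correct with probability at most
`1 / (2^n - 1) ≤ 2 / 2^n`. -/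
lemma expect_guess_le (hn : 0 < n) (μ : PMF (Bits n)) :
    (𝔼 gs ∈ simonPairs n, (μ gs.2).toReal) ≤ 2 / 2 ^ n := by
  have hμ : ∑ s, (μ s).toReal = 1 := by
    rw [← ENNReal.toReal_sum fun s _ => μ.apply_ne_top s, ← tsum_fintype (L := .unconditional _),
      μ.tsum_coe, ENNReal.toReal_one]
  calc (𝔼 gs ∈ simonPairs n, (μ gs.2).toReal)
      = 𝔼 gs ∈ simonPairs n, ∑ s, (if gs.2 = s then (1 : ℝ) else 0) * (μ s).toReal := by
        simp
    _ = ∑ s, (𝔼 gs ∈ simonPairs n, if gs.2 = s then (1 : ℝ) else 0) * (μ s).toReal := by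
        rw [Finset.expect_sum_comm]
        simp only [Finset.expect_mul]
    _ ≤ ∑ s, 2 / 2 ^ n * (μ s).toReal :=
        Finset.sum_le_sum fun s _ =>
          mul_le_mul_of_nonneg_right (expect_period_eq_le hn s) ENNReal.toReal_nonneg
    _ = 2 / 2 ^ n := by rw [← Finset.mul_sum, hμ, mul_one]

/-! ### The bound on the success probability -/

lemma expect_le_of_nonneg {ι : Type*} {s : Finset ι} {f : ι → ℝ} {a : ℝ} (ha : 0 ≤ a)
    (h : ∀ i ∈ s, f i ≤ a) : 𝔼 i ∈ s, f i ≤ a := by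
  rcases s.eq_empty_or_nonempty with rfl | hs
  · simpa using ha
  · exact Finset.expect_le hs h

/-- Measurement statistics change little when the state does. -/
lemma sum_weight_le (M S : Op q) (p : Bits q → ℝ) (hp : ∀ z, 0 ≤ p z) (hp1 : ∀ z, p z ≤ 1) :
    ∑ z, (∑ w, ‖M z w‖ ^ 2) * p z
      ≤ 2 * ∑ z, (∑ w, ‖S z w‖ ^ 2) * p z + 2 * ‖M - S‖ ^ 2 := by
  rw [frobenius_sq, Finset.mul_sum, Finset.mul_sum, ← Finset.sum_add_distrib]
  refine Finset.sum_le_sum fun z _ => ?_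
  have h : ∑ w, ‖M z w‖ ^ 2 ≤ 2 * ∑ w, ‖S z w‖ ^ 2 + 2 * ∑ w, ‖(M - S) z w‖ ^ 2 := by
    rw [Finset.mul_sum, Finset.mul_sum, ← Finset.sum_add_distrib]
    refine Finset.sum_le_sum fun w _ => ?_
    have htri : ‖M z w‖ ≤ ‖S z w‖ + ‖(M - S) z w‖ := by
      rw [Matrix.sub_apply]
      exact norm_le_norm_add_norm_sub' _ _
    nlinarith [norm_nonneg (M z w), sq_nonneg (‖S z w‖ - ‖(M - S) z w‖)]
  have hD : 0 ≤ ∑ w, ‖(M - S) z w‖ ^ 2 := by positivity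
  nlinarith [mul_le_mul_of_nonneg_right h (hp z), mul_le_of_le_one_right hD (hp1 z)]

lemma QNCCircuit.expect_outputProb_le (hn : 0 < n) (A : QNCCircuit n d q)
    (post : Bits q → PMF (Bits n)) (B : Op q) (hB : ‖B‖ ^ 2 = 1) (f : Bits n → Bits n) :
    (𝔼 gs ∈ simonPairs n, 𝔼 h : Equiv.Perm (Bits n), 𝔼 t : Fin d → (Bits n ↪ Bits (n + n)),
      A.outputProb post (B * Bᴴ) { f := f, g := gs.1, h := h, t := t } gs.2)
      ≤ (4 + 8 * d ^ 2 * q) / 2 ^ n := by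
  have hpost : ∀ z s, (post z s).toReal ≤ 1 := fun z s =>
    ENNReal.toReal_le_of_le_ofReal one_pos.le (by simpa using (post z).coe_le_one s)
  -- the shadow state does not depend on `g` and `h`; its values are taken at `g = f` and `h = 1`
  let St : (Fin d → (Bits n ↪ Bits (n + n))) → (∀ i, Fin (A.queries i).num → Bits n) → Op q :=
    fun t y => A.evolve (A.shadowOp ⟨f, f, 1, t⟩ y) B (Fin.last d)
  have hSt : ∀ g h t y, A.evolve (A.shadowOp ⟨f, g, h, t⟩ y) B (Fin.last d) = St t y :=
    fun g h t y => A.evolve_shadowOp_congr y B _ rfl fun _ _ => rfl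
  have hStn : ∀ t y, ‖St t y‖ ^ 2 = 1 := fun t y => by
    rw [← hB]
    congr 1
    exact A.norm_evolve (fun i => (A.queries i).conjTranspose_mul_self _) B _
  let D : (Bits n → Bits n) → Equiv.Perm (Bits n) → (Fin d → (Bits n ↪ Bits (n + n))) →
      (∀ i, Fin (A.queries i).num → Bits n) → ℝ := fun g h t y =>
    ‖A.evolve (fun i => (A.queries i).unitary ⟨f, g, h, t⟩ (y i)) B (Fin.last d)
      - A.evolve (A.shadowOp ⟨f, g, h, t⟩ y) B (Fin.last d)‖ ^ 2
  have hpoint : ∀ g h t s, A.outputProb post (B * Bᴴ) { f := f, g := g, h := h, t := t } s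
      ≤ 2 * (𝔼 y ∈ A.samples f, ∑ z, (∑ w, ‖St t y z w‖ ^ 2) * (post z s).toReal)
        + 2 * 𝔼 y ∈ A.samples f, D g h t y := by
    intro g h t s
    rw [A.outputProb_eq_expect, Finset.mul_expect, Finset.mul_expect, ← Finset.expect_add_distrib]
    refine Finset.expect_le_expect fun y _ => ?_
    simp only [D, hSt]
    exact sum_weight_le _ _ _ (fun z => ENNReal.toReal_nonneg) fun z => hpost z s
  have hguess : (𝔼 gs ∈ simonPairs n, 𝔼 _h : Equiv.Perm (Bits n), 𝔼 t, 𝔼 y ∈ A.samples f,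
      ∑ z, (∑ w, ‖St t y z w‖ ^ 2) * (post z gs.2).toReal) ≤ 2 / 2 ^ n := by
    rw [Finset.expect_comm]
    refine expect_le_of_nonneg (by positivity) fun _ _ => ?_
    rw [Finset.expect_comm]
    refine expect_le_of_nonneg (by positivity) fun t _ => ?_
    rw [Finset.expect_comm]
    refine expect_le_of_nonneg (by positivity) fun y _ => ?_
    rw [Finset.expect_sum_comm]
    simp only [← Finset.mul_expect]
    calc _ ≤ ∑ z, (∑ w, ‖St t y z w‖ ^ 2) * (2 / 2 ^ n) :=
          Finset.sum_le_sum fun z _ =>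
            mul_le_mul_of_nonneg_left (expect_guess_le hn (post z)) (by positivity)
      _ = 2 / 2 ^ n := by rw [← Finset.sum_mul, ← frobenius_sq, hStn, one_mul]
  have hhybrid : (𝔼 gs ∈ simonPairs n, 𝔼 h, 𝔼 t, 𝔼 y ∈ A.samples f, D gs.1 h t y)
      ≤ 4 * d ^ 2 * q / 2 ^ n := by
    refine expect_le_of_nonneg (by positivity) fun gs _ => ?_
    have hcomm : (𝔼 h, 𝔼 t, 𝔼 y ∈ A.samples f, D gs.1 h t y)
        = 𝔼 y ∈ A.samples f, 𝔼 h, 𝔼 t, D gs.1 h t y :=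
      (Finset.expect_congr rfl fun h _ => Finset.expect_comm _ _ _).trans (Finset.expect_comm _ _ _)
    rw [hcomm]
    refine expect_le_of_nonneg (by positivity) fun y _ => ?_
    refine (A.expect_norm_evolve_sub_sq_le hn f gs.1 y B).trans_eq ?_
    rw [hB, mul_one]
  calc _ ≤ 𝔼 gs ∈ simonPairs n, 𝔼 h : Equiv.Perm (Bits n), 𝔼 t,
        (2 * (𝔼 y ∈ A.samples f, ∑ z, (∑ w, ‖St t y z w‖ ^ 2) * (post z gs.2).toReal)
        + 2 * 𝔼 y ∈ A.samples f, D gs.1 h t y) :=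
        Finset.expect_le_expect fun gs _ => Finset.expect_le_expect fun h _ =>
          Finset.expect_le_expect fun t _ => hpoint gs.1 h t gs.2
    _ = 2 * (𝔼 gs ∈ simonPairs n, 𝔼 _h : Equiv.Perm (Bits n), 𝔼 t, 𝔼 y ∈ A.samples f,
          ∑ z, (∑ w, ‖St t y z w‖ ^ 2) * (post z gs.2).toReal)
        + 2 * 𝔼 gs ∈ simonPairs n, 𝔼 h, 𝔼 t, 𝔼 y ∈ A.samples f, D gs.1 h t y := by
        simp only [Finset.expect_add_distrib, ← Finset.mul_expect]
    _ ≤ 2 * (2 / 2 ^ n) + 2 * (4 * d ^ 2 * q / 2 ^ n) := by gcongr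
    _ = _ := by ring

lemma twoToOne_zero : twoToOne 0 = ∅ := by
  refine Finset.eq_empty_of_forall_notMem fun f hf => ?_
  classical
  rw [twoToOne, Finset.mem_filter] at hf
  obtain ⟨x, ⟨hx, -⟩, -⟩ := hf.2 0
  exact hx (Subsingleton.elim _ _)

lemma QNCCircuit.successProb_le (A : QNCCircuit n d q) (post : Bits q → PMF (Bits n)) {ρ₀ : Op q}
    (hρ : IsDensity ρ₀) : A.successProb post ρ₀ ≤ (4 + 8 * d ^ 2 * q) / 2 ^ n := by
  obtain ⟨B, rfl⟩ := exists_eq_mul_conjTranspose hρ.1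
  have hB : ‖B‖ ^ 2 = 1 := by rw [frobenius_sq_eq_trace, hρ.2, Complex.one_re]
  rcases Nat.eq_zero_or_pos n with rfl | hn
  · rw [QNCCircuit.successProb, twoToOne_zero, Finset.expect_empty]
    positivity
  · exact expect_le_of_nonneg (by positivity) fun f _ => A.expect_outputProb_le hn post B hB f

lemma negligible_two_pow_inv : Negligible fun n => ((2 : ℝ) ^ n)⁻¹ := fun k => by
  simpa [div_eq_mul_inv] using
    tendsto_pow_const_div_const_pow_of_one_lt k (one_lt_two (α := ℝ))

lemma negligible_of_polyBounded {d q : ℕ → ℕ} (hd : PolyBounded d) (hq : PolyBounded q) :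
    Negligible fun n => (4 + 8 * (d n : ℝ) ^ 2 * q n) / 2 ^ n := by
  obtain ⟨P, hP⟩ := hd
  obtain ⟨Q, hQ⟩ := hq
  have h := negligible_two_pow_inv.polynomial_mul ((4 + 8 * P ^ 2 * Q).map (Nat.castRingHom ℝ))
  refine Asymptotics.SuperpolynomialDecay.trans_abs_le h fun n => ?_
  have heval : ((4 + 8 * P ^ 2 * Q).map (Nat.castRingHom ℝ)).eval (n : ℝ)
      = 4 + 8 * ((P.eval n : ℕ) : ℝ) ^ 2 * (Q.eval n : ℕ) := by
    simp [Polynomial.eval_natCast_map]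
  have hPn : (d n : ℝ) ≤ (P.eval n : ℕ) := by exact_mod_cast hP n
  have hQn : (q n : ℝ) ≤ (Q.eval n : ℕ) := by exact_mod_cast hQ n
  simp only [heval, ← div_eq_mul_inv]
  rw [abs_of_nonneg (by positivity), abs_of_nonneg (by positivity)]
  gcongr

end SCS

theorem mainTheorem8 (d q : ℕ → ℕ) (hd : SCS.PolyBounded d) (hq : SCS.PolyBounded q) :
    ∃ ε : ℕ → ℝ, SCS.Negligible ε ∧
      ∀ (n : ℕ) (A : SCS.QNCCircuit n (d n) (q n)) (post : SCS.Bits (q n) → PMF (SCS.Bits n))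
        (ρ₀ : SCS.Op (q n)), SCS.IsDensity ρ₀ → A.successProb post ρ₀ ≤ ε n :=
  ⟨_, SCS.negligible_of_polyBounded hd hq, fun _ A post _ hρ => A.successProb_le post hρ⟩
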